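/- Let $(R,\mathfrak m)$ be a regular local ring of dimension $n$ and of prime characteristic $p>0$, let $x_1,\dots,x_n$ be a regular system of parameters of $R$, and let $\mathfrak a$ be an ideal with $(0)\neq\mathfrak a\subseteq\mathfrak m$. Let $E=H^n_{\mathfrak m}(R)$ be the top local cohomology module, represented by the Čech complex on $x_1,\dots,x_n$ as $$E=R_{x_1\cdots x_n}\Big/\sum_{i=1}^n R_{x_1\cdots\widehat{x_i}\cdots x_n},$$ and let $F_E\colon E\to E$ be its Frobenius morphism, $F_E([u/(x_1\cdots x_n)^d])=[u^p/(x_1\cdots x_n)^{pd}]$. For a real number $c>0$ put $$Z_c=\bigcap_{e\geq 1}\ker\big(\mathfrak a^{\lceil cp^e\rceil}F_E^e\big),\qquad \ker(\mathfrak a^{r}F_E^e)=\{w\in E\mid hF_E^e(w)=0\ \text{for all}\ h\in\mathfrak a^{r}\}.$$ Call an $R$-submodule $N\subseteq E$ invariant if $hF_E^e(N)\subseteq N$ for all $e\geq 1$ and all $h\in\mathfrak a^{\lceil cp^e\rceil}$. Then, for every real $c>0$, $Z_c$ is the unique maximal proper invariant submodule of $E$. That is, $Z_c$ is a proper invariant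 submodule of $E$, it contains every proper invariant submodule of $E$, and it is the only maximal element (with respect to inclusion) of the set of proper invariant submodules of $E$. -/

import Mathlib

open IsLocalRing

noncomputable section

namespace TopCech

variable {R : Type*} [CommRing R] {n : ℕ}

/-- The ring `R_{x_1 ⋯ x_n}`. -/
abbrev TopRing (x : Fin n → R) : Type _ := Localization.Away (∏ j, x j)

/-- The ring `R_{x_1 ⋯ x̂_i ⋯ x_n}`, the `i`-th element being omitted. -/
abbrev FaceRing (x : Fin n → R) (i : Fin n) : Type _ :=
  Localization.Away (∏ j ∈ Finset.univ.erase i, x j)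

theorem isUnit_face (x : Fin n → R) (i : Fin n)
    (y : Submonoid.powers (∏ j ∈ Finset.univ.erase i, x j)) :
    IsUnit (Algebra.ofId R (TopRing x) y) := by
  obtain ⟨_, d, rfl⟩ := y
  simp only [map_pow]
  refine IsUnit.pow d ?_
  have h : IsUnit (algebraMap R (TopRing x) (∏ j, x j)) :=
    IsLocalization.Away.algebraMap_isUnit _
  exact isUnit_of_dvd_unit
    (map_dvd _ (Finset.prod_dvd_prod_of_subset _ _ x (Finset.erase_subset i Finset.univ))) h

/-- The canonical map `R_{x_1 ⋯ x̂_i ⋯ x_n} → R_{x_1 ⋯ x_n}`. -/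
def faceMap (x : Fin n → R) (i : Fin n) : FaceRing x i →ₐ[R] TopRing x :=
  IsLocalization.liftAlgHom (M := Submonoid.powers (∏ j ∈ Finset.univ.erase i, x j))
    (f := Algebra.ofId R (TopRing x)) (isUnit_face x i)

/-- The `R`-submodule `∑ i, R_{x_1 ⋯ x̂_i ⋯ x_n}` of `R_{x_1 ⋯ x_n}`. -/
def boundary (x : Fin n → R) : Submodule R (TopRing x) :=
  ⨆ i, LinearMap.range (faceMap x i).toLinearMap

/-- The top cohomology `R_{x_1 ⋯ x_n} / ∑ i, R_{x_1 ⋯ x̂_i ⋯ x_n}` of the Čech complex of `R` on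
`x_1, …, x_n`. If `R` is a Noetherian local ring and `x_1, …, x_n` generate an ideal that is primary
to the maximal ideal `𝔪`, this is the local cohomology module `H^n_𝔪(R)`. -/
abbrev E (x : Fin n → R) : Type _ := TopRing x ⧸ boundary x

/-- The class `[u / (x_1 ⋯ x_n)^d]` in `E`. -/
def cls (x : Fin n → R) (u : R) (d : ℕ) : E x :=
  Submodule.Quotient.mk (Localization.mk u ⟨(∏ j, x j) ^ d, d, rfl⟩)

variable (p : ℕ) [ExpChar R p]

theorem powers_le_comap_frobenius (f : R) :
    Submonoid.powers f ≤ (Submonoid.powers f).comap (frobenius R p) := by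
  rintro _ ⟨d, rfl⟩
  exact ⟨d * p, by simp [frobenius_def, pow_mul]⟩

/-- The Frobenius `u / f ^ d ↦ u ^ p / f ^ (p * d)` of a localization `R_f`. -/
def frobAway (f : R) : Localization.Away f →+* Localization.Away f :=
  IsLocalization.map (Localization.Away f) (frobenius R p) (powers_le_comap_frobenius p f)

theorem frobAway_eq_pow (f : R) (z : Localization.Away f) : frobAway p f z = z ^ p := by
  obtain ⟨u, s, rfl⟩ := IsLocalization.exists_mk'_eq (Submonoid.powers f) z
  rw [frobAway, IsLocalization.map_mk', ← IsLocalization.mk'_pow]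
  rfl

/-- The Frobenius of `R_{x_1 ⋯ x_n}`, as a map that is semilinear over the Frobenius of `R`. -/
def frobTop (x : Fin n → R) : TopRing x →ₛₗ[frobenius R p] TopRing x where
  toFun := frobAway p (∏ j, x j)
  map_add' := map_add _
  map_smul' r z := by
    simp only [frobAway_eq_pow, Algebra.smul_def, mul_pow, frobenius_def, map_pow]

theorem boundary_le_comap (x : Fin n → R) :
    boundary x ≤ (boundary x).comap (frobTop p x) := by
  refine iSup_le fun i => ?_
  rintro _ ⟨z, rfl⟩
  refine Submodule.mem_iSup_of_mem i ⟨z ^ p, ?_⟩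
  change faceMap x i (z ^ p) = frobAway p _ (faceMap x i z)
  rw [frobAway_eq_pow, map_pow]

/-- The Frobenius morphism `F_E` of `E`: it sends `[u / (x_1 ⋯ x_n)^d]` to
`[u^p / (x_1 ⋯ x_n)^(p d)]`. -/
def FE (x : Fin n → R) : E x →ₛₗ[frobenius R p] E x :=
  Submodule.mapQ (boundary x) (boundary x) (frobTop p x) (boundary_le_comap p x)

theorem FE_cls (x : Fin n → R) (u : R) (d : ℕ) :
    FE p x (cls x u d) = cls x (u ^ p) (p * d) := by
  change Submodule.Quotient.mk (frobAway p _ _) = _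
  rw [frobAway_eq_pow, Localization.mk_pow, cls]
  congr 2
  ext
  simp [← pow_mul, mul_comm]

theorem iterate_FE_zero (x : Fin n → R) (e : ℕ) : (FE p x)^[e] 0 = 0 :=
  iterate_map_zero _ _

theorem iterate_FE_add (x : Fin n → R) (e : ℕ) (v w : E x) :
    (FE p x)^[e] (v + w) = (FE p x)^[e] v + (FE p x)^[e] w :=
  iterate_map_add _ _ _ _

theorem iterate_FE_smul (x : Fin n → R) (e : ℕ) (g : R) (w : E x) :
    (FE p x)^[e] (g • w) = g ^ p ^ e • (FE p x)^[e] w := by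
  induction e with
  | zero => simp
  | succ e ih =>
    rw [Function.iterate_succ_apply', Function.iterate_succ_apply', ih, LinearMap.map_smulₛₗ,
      frobenius_def, ← pow_mul, pow_succ]

/-- `Z_{r,e} = Ker (𝔞^r F_E^e) = {w ∈ E | h F_E^e(w) = 0 for all h ∈ 𝔞^r}`. -/
def kerPow (x : Fin n → R) (a : Ideal R) (r e : ℕ) : Submodule R (E x) where
  carrier := {w | ∀ h ∈ a ^ r, h • (FE p x)^[e] w = 0}
  zero_mem' h _ := by rw [iterate_FE_zero, smul_zero]
  add_mem' hv hw h hh := by rw [iterate_FE_add, smul_add, hv h hh, hw h hh, add_zero]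
  smul_mem' g w hw h hh := by rw [iterate_FE_smul, smul_comm, hw h hh, smul_zero]

/-- `Z_c = ⋂_{e ≥ 1} Z_{⌈c p^e⌉, e}`. -/
def Z (x : Fin n → R) (a : Ideal R) (c : ℝ) : Submodule R (E x) :=
  ⨅ (e : ℕ) (_ : 1 ≤ e), kerPow p x a ⌈c * (p : ℝ) ^ e⌉₊ e

/-- `N` is invariant under all the maps `h F_E^e` with `e ≥ 1` and `h ∈ 𝔞^⌈c p^e⌉`. -/
def IsInvariant (x : Fin n → R) (a : Ideal R) (c : ℝ) (N : Submodule R (E x)) : Prop :=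
  ∀ e : ℕ, 1 ≤ e → ∀ h ∈ a ^ ⌈c * (p : ℝ) ^ e⌉₊, ∀ w ∈ N, h • (FE p x)^[e] w ∈ N

end TopCech

end

/-!
Since `R` is a domain and every permutation of a regular system of parameters is a regular sequence,
`[u / (x_1 ⋯ x_n)^d] = 0` exactly when `u ∈ (x_1^d, …, x_n^d)`. By Krull's intersection theorem no
nonzero `h : R` kills `E`. As the image of `F_E` spans `E`, no nonzero `h` kills that image either,
and so `Z_c ≠ E`.

The socle of `R / (x_1^d, …, x_n^d)` is generated by `(x_1 ⋯ x_n)^(d - 1)`, so every nonzero element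
of `E` has the socle element `η = [1 / (x_1 ⋯ x_n)]` as a multiple. If `N` is invariant and
`h F_E^e(w) ≠ 0` for some `w ∈ N` and `h ∈ 𝔞^⌈c p^e⌉`, choose `r` with `r h F_E^e(w) = η`. Then
`F_E^k(η) = r^(p^k) h^(p^k) F_E^(k + e)(w)` lies in `N` for all `k`, because
`h^(p^k) ∈ 𝔞^⌈c p^(k + e)⌉`. These elements `[1 / (x_1 ⋯ x_n)^(p^k)]` generate `E`, so `N = E`.
-/

section PowerIdeals

variable {R ι : Type*} [CommRing R] {I : Ideal R} {y z : R}

theorem isSMulRegular_quotient_span_pow_sup (hz : IsSMulRegular (R ⧸ Ideal.span {y} ⊔ I) z)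
    (hy : IsSMulRegular (R ⧸ I) y) (k : ℕ) : IsSMulRegular (R ⧸ Ideal.span {y ^ k} ⊔ I) z := by
  rw [isSMulRegular_quotient_iff_mem_of_smul_mem] at hz ⊢
  simp only [smul_eq_mul, Ideal.mem_span_singleton_sup] at hz ⊢
  induction k with
  | zero => exact fun u _ => ⟨u, 0, I.zero_mem, by ring⟩
  | succ k ih =>
    rintro u ⟨r, t, ht, hu⟩
    obtain ⟨s, t', ht', rfl⟩ := ih u ⟨r * y, t, ht, by rw [← hu]; ring⟩
    have hsr : z * s - r * y ∈ I := by
      refine mem_of_isSMulRegular_quotient_of_smul_mem (hy.pow k) ?_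
      rw [smul_eq_mul, show y ^ k * (z * s - r * y) = t - z * t' by linear_combination -hu]
      exact sub_mem ht (I.mul_mem_left z ht')
    obtain ⟨q, t'', ht'', rfl⟩ := hz s ⟨r, _, hsr, by ring⟩
    exact ⟨q, t'' * y ^ k + t', add_mem (I.mul_mem_right _ ht'') ht', by ring⟩

theorem mem_span_pow_sup_of_mul_pow_mem (hy : IsSMulRegular (R ⧸ I) y) {u : R} {k l : ℕ}
    (hu : u * y ^ l ∈ Ideal.span {y ^ (k + l)} ⊔ I) : u ∈ Ideal.span {y ^ k} ⊔ I := by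
  obtain ⟨r, t, ht, hr⟩ := Ideal.mem_span_singleton_sup.1 hu
  refine Ideal.mem_span_singleton_sup.2 ⟨r, u - r * y ^ k, ?_, by ring⟩
  refine mem_of_isSMulRegular_quotient_of_smul_mem (hy.pow l) ?_
  rwa [smul_eq_mul, show y ^ l * (u - r * y ^ k) = t by linear_combination -hr]

theorem mul_pow_mem_span_pow_sup {u : R} {k : ℕ} (l : ℕ) (hu : u ∈ Ideal.span {y ^ k} ⊔ I) :
    u * y ^ l ∈ Ideal.span {y ^ (k + l)} ⊔ I := by
  obtain ⟨s, t, ht, rfl⟩ := Ideal.mem_span_singleton_sup.1 hu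
  exact Ideal.mem_span_singleton_sup.2 ⟨s, t * y ^ l, I.mul_mem_right _ ht, by ring⟩

theorem exists_mul_sub_mul_pow_mem_span_pow_sup {m : R}
    (hm : ∀ u ∉ Ideal.span {y} ⊔ I, ∃ r, r * u - m ∈ Ideal.span {y} ⊔ I) (k : ℕ) :
    ∀ u ∉ Ideal.span {y ^ (k + 1)} ⊔ I,
      ∃ r, r * u - m * y ^ k ∈ Ideal.span {y ^ (k + 1)} ⊔ I := by
  have mul_pow_mem {v : R} (hv : v ∈ Ideal.span {y} ⊔ I) (k : ℕ) :
      v * y ^ k ∈ Ideal.span {y ^ (k + 1)} ⊔ I := by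
    rw [add_comm]
    exact mul_pow_mem_span_pow_sup k (by rwa [pow_one])
  induction k with
  | zero => simpa using hm
  | succ k ih =>
    intro u hu
    by_cases huk : u ∈ Ideal.span {y ^ (k + 1)} ⊔ I
    · obtain ⟨s, t, ht, rfl⟩ := Ideal.mem_span_singleton_sup.1 huk
      have hs : s ∉ Ideal.span {y} ⊔ I := fun hs =>
        hu <| add_mem (mul_pow_mem hs (k + 1)) (Ideal.mem_sup_right ht)
      obtain ⟨r, hr⟩ := hm s hs
      refine ⟨r, ?_⟩
      rw [show r * (s * y ^ (k + 1) + t) - m * y ^ (k + 1) =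
        (r * s - m) * y ^ (k + 1) + r * t by ring]
      exact add_mem (mul_pow_mem hr (k + 1)) (Ideal.mem_sup_right (I.mul_mem_left r ht))
    · obtain ⟨r, hr⟩ := ih u huk
      refine ⟨r * y, ?_⟩
      rw [show r * y * u - m * y ^ (k + 1) = (r * u - m * y ^ k) * y ^ 1 by ring]
      exact mul_pow_mem_span_pow_sup 1 hr

/-- The ideal generated by the powers `x i ^ a i` for `i ∈ S`. The partial index sets `S` are
needed for inductions on the number of generators. -/
def spanPow (x : ι → R) (a : ι → ℕ) (S : Set ι) : Ideal R :=
  Ideal.span ((fun i => x i ^ a i) '' S)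

variable {x : ι → R} {a : ι → ℕ} {S : Set ι}

theorem spanPow_one : spanPow x 1 S = Ideal.span (x '' S) := by
  simp [spanPow]

theorem pow_mem_spanPow {i : ι} (hi : i ∈ S) {k : ℕ} (hk : a i ≤ k) : x i ^ k ∈ spanPow x a S :=
  (spanPow x a S).pow_mem_of_pow_mem (Ideal.subset_span (Set.mem_image_of_mem _ hi)) hk

theorem spanPow_le_iff : spanPow x a S ≤ I ↔ ∀ i ∈ S, x i ^ a i ∈ I := by
  rw [spanPow, Ideal.span_le, Set.image_subset_iff]
  rfl

theorem spanPow_congr {b : ι → ℕ} (h : Set.EqOn a b S) : spanPow x a S = spanPow x b S :=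
  congrArg Ideal.span (Set.image_congr fun i hi => by rw [h hi])

theorem spanPow_eq_sup {i : ι} (hi : i ∈ S) :
    spanPow x a S = Ideal.span {x i ^ a i} ⊔ spanPow x a (S \ {i}) := by
  conv_lhs => rw [← Set.insert_sdiff_self_of_mem hi]
  rw [spanPow, Set.image_insert_eq, Ideal.span_insert, spanPow]

theorem spanPow_update_eq_sup [DecidableEq ι] {i : ι} (hi : i ∈ S) (k : ℕ) :
    spanPow x (Function.update a i k) S = Ideal.span {x i ^ k} ⊔ spanPow x a (S \ {i}) := by
  rw [spanPow_eq_sup hi, Function.update_self,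
    spanPow_congr fun j hj => Function.update_of_ne hj.2 k a]

theorem mul_prod_pow_mem_spanPow [Fintype ι] {b : ι → ℕ} {u : R}
    (hu : u ∈ spanPow x a Set.univ) : u * ∏ i, x i ^ b i ∈ spanPow x (a + b) Set.univ := by
  have hle : spanPow x a Set.univ ≤
      Submodule.comap (LinearMap.mulRight R (∏ i, x i ^ b i)) (spanPow x (a + b) Set.univ) := by
    refine spanPow_le_iff.2 fun j _ => ?_
    rw [Submodule.mem_comap, LinearMap.mulRight_apply]
    refine Ideal.mem_of_dvd _ ?_ (pow_mem_spanPow (Set.mem_univ j) le_rfl)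
    rw [Pi.add_apply, pow_add]
    exact mul_dvd_mul_left _ (Finset.dvd_prod_of_mem _ (Finset.mem_univ j))
  exact hle hu

theorem exists_mul_sub_prod_pow_mem_spanPow [Fintype ι] [IsLocalRing R]
    (hx : Ideal.span (Set.range x) = maximalIdeal R) (a : ι → ℕ) :
    ∀ u ∉ spanPow x (a + 1) Set.univ,
      ∃ r, r * u - ∏ i, x i ^ a i ∈ spanPow x (a + 1) Set.univ := by
  classical
  suffices h : ∀ (T : Finset ι), ∀ u ∉ spanPow x (T.piecewise (a + 1) 1) Set.univ,
      ∃ r, r * u - ∏ i ∈ T, x i ^ a i ∈ spanPow x (T.piecewise (a + 1) 1) Set.univ by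
    simpa using h Finset.univ
  intro T
  induction T using Finset.induction_on with
  | empty =>
    intro u hu
    rw [Finset.piecewise_empty, spanPow_one, Set.image_univ, hx, mem_maximalIdeal,
      mem_nonunits_iff, not_not] at hu
    obtain ⟨r, hr⟩ := hu.exists_left_inv
    exact ⟨r, by simp [hr]⟩
  | insert i T hi ih =>
    rw [spanPow_eq_sup (Set.mem_univ i), Finset.piecewise_eq_of_notMem _ _ _ hi, Pi.one_apply,
      pow_one] at ih
    rw [Finset.piecewise_insert, spanPow_update_eq_sup (Set.mem_univ i), Finset.prod_insert hi,
      mul_comm]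
    exact exists_mul_sub_mul_pow_mem_span_pow_sup ih (a i)

/-- A family that is a weakly regular sequence in every order: each member is a nonzerodivisor
modulo the ideal generated by any set of other members. The ideal generated by the whole family is
not required to be proper. -/
def IsPermutablyRegular (x : ι → R) : Prop :=
  ∀ (S : Set ι), ∀ j ∉ S, IsSMulRegular (R ⧸ Ideal.span (x '' S)) (x j)

namespace IsPermutablyRegular

theorem isSMulRegular_quotient_spanPow [Finite ι] (hx : IsPermutablyRegular x) (a : ι → ℕ)
    {j : ι} (hj : j ∉ S) : IsSMulRegular (R ⧸ spanPow x a S) (x j) := by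
  classical
  have := Fintype.ofFinite ι
  suffices h : ∀ (T : Finset ι) (S : Set ι), ∀ j ∉ S,
      IsSMulRegular (R ⧸ spanPow x (T.piecewise a 1) S) (x j) by
    rw [← Finset.piecewise_univ a 1]
    exact h Finset.univ S j hj
  intro T
  induction T using Finset.induction_on with
  | empty =>
    intro S j hj
    rw [Finset.piecewise_empty, spanPow_one]
    exact hx S j hj
  | insert i T hi ih =>
    intro S j hj
    rw [Finset.piecewise_insert]
    by_cases hiS : i ∈ S
    · have hji := ih S j hj
      rw [spanPow_eq_sup hiS, Finset.piecewise_eq_of_notMem _ _ _ hi, Pi.one_apply, pow_one] at hji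
      rw [spanPow_update_eq_sup hiS]
      exact isSMulRegular_quotient_span_pow_sup hji (ih _ i fun h => h.2 rfl) (a i)
    · rw [spanPow_congr fun l hl => Function.update_of_ne (ne_of_mem_of_not_mem hl hiS) _ _]
      exact ih S j hj

theorem mem_spanPow_of_mul_prod_pow_mem [Fintype ι] (hx : IsPermutablyRegular x) {a b : ι → ℕ}
    {u : R} (hu : u * ∏ i, x i ^ b i ∈ spanPow x (a + b) Set.univ) :
    u ∈ spanPow x a Set.univ := by
  classical
  suffices h : ∀ T : Finset ι,
      u * ∏ i ∈ T, x i ^ b i ∈ spanPow x (T.piecewise (a + b) a) Set.univ →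
        u ∈ spanPow x a Set.univ from
    h Finset.univ (by simpa using hu)
  intro T
  induction T using Finset.induction_on with
  | empty => simp
  | insert i T hi ih =>
    intro hu
    refine ih ?_
    rw [Finset.piecewise_insert, spanPow_update_eq_sup (Set.mem_univ i), Finset.prod_insert hi,
      mul_left_comm, mul_comm, Pi.add_apply] at hu
    rw [spanPow_eq_sup (Set.mem_univ i), Finset.piecewise_eq_of_notMem _ _ _ hi]
    exact mem_span_pow_sup_of_mul_pow_mem
      (hx.isSMulRegular_quotient_spanPow _ fun h => h.2 rfl) hu

end IsPermutablyRegular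

end PowerIdeals

section RegularLocalRing

theorem span_insert_erase_of_isUnit {R M : Type*} [Ring R] [AddCommGroup M] [Module R M]
    [DecidableEq M] {s : Finset M} {f : M → R} {y : M} (hy : y ∈ s) (hu : IsUnit (f y)) :
    Submodule.span R (insert (∑ a ∈ s, f a • a) (s.erase y : Set M)) = Submodule.span R s := by
  have hsub : (s.erase y : Set M) ⊆ s := by simp
  refine le_antisymm (Submodule.span_le.2 (Set.insert_subset ?_ ?_)) (Submodule.span_le.2 ?_)
  · exact sum_mem fun a ha => Submodule.smul_mem _ _ (Submodule.subset_span ha)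
  · exact hsub.trans Submodule.subset_span
  · intro b hb
    obtain rfl | hby := eq_or_ne b y
    · rw [SetLike.mem_coe, ← Submodule.smul_mem_iff_of_isUnit _ hu,
        eq_sub_of_add_eq (Finset.add_sum_erase s (fun a => f a • a) hy)]
      refine sub_mem (Submodule.subset_span (Set.mem_insert _ _)) (sum_mem fun a ha => ?_)
      exact Submodule.smul_mem _ _ (Submodule.subset_span (Set.mem_insert_of_mem _ ha))
    · exact Submodule.subset_span (Set.mem_insert_of_mem _ (Finset.mem_erase.2 ⟨hby, hb⟩))

universe u

variable {R : Type u} [CommRing R]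

theorem exists_span_insert_eq_maximalIdeal [IsLocalRing R] [IsNoetherianRing R] {z : R}
    (hz : z ∈ maximalIdeal R) (hz2 : z ∉ maximalIdeal R ^ 2) :
    ∃ t : Finset R, t.card + 1 = (maximalIdeal R).spanFinrank ∧
      Ideal.span (insert z (t : Set R)) = maximalIdeal R := by
  classical
  obtain ⟨s, hcard, hs⟩ := (IsNoetherian.noetherian
    (maximalIdeal R)).exists_span_finset_card_eq_spanFinrank
  obtain ⟨f, -, rfl⟩ := Submodule.mem_span_finset.1 (hs ▸ hz)
  obtain ⟨y, hy, hu⟩ : ∃ y ∈ s, IsUnit (f y) := by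
    by_contra! hf
    refine hz2 (sum_mem fun a ha => ?_)
    rw [pow_two]
    exact Ideal.mul_mem_mul ((mem_maximalIdeal _).2 (hf a ha)) (hs ▸ Submodule.subset_span ha)
  exact ⟨s.erase y, (Finset.card_erase_add_one hy).trans hcard,
    (span_insert_erase_of_isUnit hy hu).trans hs⟩

theorem exists_mem_maximalIdeal_notMem_sq_notMem_minimalPrimes [IsLocalRing R]
    [IsNoetherianRing R] (hR : ringKrullDim R ≠ 0) :
    ∃ z ∈ maximalIdeal R, z ∉ maximalIdeal R ^ 2 ∧ ∀ q ∈ minimalPrimes R, z ∉ q := by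
  by_contra! h
  have hcover : (maximalIdeal R : Set R) ⊆
      ⋃ I ∈ insert (maximalIdeal R ^ 2) (minimalPrimes R), (I : Set R) := by
    intro z hz
    by_cases hz2 : z ∈ maximalIdeal R ^ 2
    · exact Set.mem_biUnion (Set.mem_insert _ _) hz2
    · obtain ⟨q, hq, hzq⟩ := h z hz hz2
      exact Set.mem_biUnion (Set.mem_insert_of_mem _ hq) hzq
  obtain ⟨I, hI, hle⟩ := (Ideal.subset_union_prime_finite (f := id)
    ((minimalPrimes.finite_of_isNoetherianRing R).insert _)
    (maximalIdeal R ^ 2) (maximalIdeal R ^ 2)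
    fun I hI hne _ => (Set.mem_of_mem_insert_of_ne hI hne).1.1).1 hcover
  rcases hI with rfl | hI
  · exact (maximalIdeal_sq_lt_of_ringKrullDim_ne_zero hR).not_ge hle
  · have hmin : maximalIdeal R ∈ minimalPrimes R :=
      le_antisymm hle (le_maximalIdeal hI.1.1.ne_top) ▸ hI
    apply hR
    rw [← maximalIdeal_height_eq_ringKrullDim, Ideal.height_eq_zero_iff.2 hmin]
    rfl

theorem isDomain_of_isPrime_span_singleton [IsNoetherianRing R] {z : R}
    (hz : z ∈ (⊥ : Ideal R).jacobson) (hmin : ∀ q ∈ minimalPrimes R, z ∉ q)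
    (hp : (Ideal.span {z}).IsPrime) : IsDomain R := by
  obtain ⟨q, hq, hqz⟩ := Ideal.exists_minimalPrimes_le (bot_le : ⊥ ≤ Ideal.span {z})
  have hqp : q.IsPrime := hq.1.1
  have hqle : q ≤ Ideal.span {z} • q := fun b hb => by
    obtain ⟨t, rfl⟩ := Ideal.mem_span_singleton.1 (hqz hb)
    exact Submodule.smul_mem_smul (Ideal.mem_span_singleton_self z)
      ((hqp.mem_or_mem hb).resolve_left (hmin q hq))
  have hq0 : q = ⊥ := Submodule.eq_bot_of_le_smul_of_le_jacobson_bot _ _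
    (IsNoetherian.noetherian q) hqle ((Ideal.span_singleton_le_iff_mem _).2 hz)
  rw [hq0] at hqp
  exact IsDomain.of_bot_isPrime R

theorem spanFinrank_maximalIdeal_quotient_le [IsLocalRing R] {I : Ideal R} [IsLocalRing (R ⧸ I)]
    {t : Finset R} (ht : I ⊔ Ideal.span t = maximalIdeal R) :
    (maximalIdeal (R ⧸ I)).spanFinrank ≤ t.card := by
  rw [← map_maximalIdeal_of_surjective _ (Ideal.Quotient.mk_surjective (I := I)), ← ht,
    Ideal.map_sup, Ideal.map_quotient_self, bot_sup_eq, Ideal.map_span]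
  refine (Submodule.spanFinrank_span_le_ncard_of_finite (t.finite_toSet.image _)).trans ?_
  exact (Set.ncard_image_le t.finite_toSet).trans (Set.ncard_coe_finset t).le

theorem isRegularLocalRing_quotient_span [IsLocalRing R] [IsNoetherianRing R] {s t : Finset R}
    (hst : Ideal.span s ⊔ Ideal.span t = maximalIdeal R)
    (hcard : ((s.card + t.card : ℕ) : WithBot ℕ∞) ≤ ringKrullDim R) :
    IsRegularLocalRing (R ⧸ Ideal.span (s : Set R)) := by
  have hs : Ideal.span (s : Set R) ≤ maximalIdeal R := hst ▸ le_sup_left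
  have : Nontrivial (R ⧸ Ideal.span (s : Set R)) :=
    Ideal.Quotient.nontrivial_iff.2 (ne_top_of_le_ne_top Ideal.IsPrime.ne_top' hs)
  have : IsLocalRing (R ⧸ Ideal.span (s : Set R)) :=
    .of_surjective' (Ideal.Quotient.mk _) Ideal.Quotient.mk_surjective
  refine .of_spanFinrank_maximalIdeal_le _ ?_
  rw [← ENat.WithBot.add_le_add_natCast_right_iff (c := s.card)]
  calc ((maximalIdeal (R ⧸ Ideal.span (s : Set R))).spanFinrank + s.card : WithBot ℕ∞)
      ≤ ((s.card + t.card : ℕ) : WithBot ℕ∞) := by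
        rw [add_comm s.card]
        exact_mod_cast Nat.add_le_add_right (spanFinrank_maximalIdeal_quotient_le hst) s.card
    _ ≤ ringKrullDim R := hcard
    _ ≤ ringKrullDim (R ⧸ Ideal.span (s : Set R)) + s.card :=
        ringKrullDim_le_ringKrullDim_quotient_add_card s
          (by rw [ringJacobson_eq_maximalIdeal]; exact Ideal.span_le.1 hs)

theorem isDomain_of_isRegularLocalRing [IsRegularLocalRing R] : IsDomain R := by
  suffices h : ∀ (k : ℕ) {R : Type u} [CommRing R] [IsRegularLocalRing R],
      (maximalIdeal R).spanFinrank ≤ k → IsDomain R from h _ le_rfl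
  intro k
  induction k with
  | zero =>
    intro R _ _ hk
    rw [Nat.le_zero, Submodule.spanFinrank_eq_zero_iff_eq_bot (IsNoetherian.noetherian _)] at hk
    exact (isField_iff_maximalIdeal_eq.2 hk).isDomain
  | succ k ih =>
    intro R _ _ hk
    by_cases hR : ringKrullDim R = 0
    · refine ih (Nat.le_of_eq ?_ |>.trans k.zero_le)
      exact_mod_cast (IsRegularLocalRing.spanFinrank_maximalIdeal (R := R)).trans hR
    obtain ⟨z, hz, hz2, hmin⟩ := exists_mem_maximalIdeal_notMem_sq_notMem_minimalPrimes hR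
    obtain ⟨t, ht, hzt⟩ := exists_span_insert_eq_maximalIdeal hz hz2
    rw [Ideal.span_insert] at hzt
    have hreg := isRegularLocalRing_quotient_span (s := {z}) (t := t)
      (by rwa [Finset.coe_singleton])
      (by rw [Finset.card_singleton, add_comm, ht, IsRegularLocalRing.spanFinrank_maximalIdeal])
    rw [Finset.coe_singleton] at hreg
    have : IsDomain (R ⧸ Ideal.span {z}) :=
      ih ((spanFinrank_maximalIdeal_quotient_le hzt).trans (by lia))
    refine isDomain_of_isPrime_span_singleton ?_ hmin ((Ideal.Quotient.isDomain_iff_prime _).1 this)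
    rwa [jacobson_eq_maximalIdeal _ bot_ne_top]

section SystemOfParameters

variable [IsLocalRing R] [IsNoetherianRing R] {ι : Type*} [Fintype ι] {x : ι → R}

theorem isPrime_span_image (hn : ringKrullDim R = Fintype.card ι)
    (hx : Ideal.span (Set.range x) = maximalIdeal R) (S : Set ι) :
    (Ideal.span (x '' S)).IsPrime := by
  classical
  have hreg : IsRegularLocalRing (R ⧸ Ideal.span ((S.toFinset.image x : Finset R) : Set R)) := by
    refine isRegularLocalRing_quotient_span (t := S.toFinsetᶜ.image x) ?_ ?_
    · rw [← Ideal.span_union, ← Finset.coe_union, ← Finset.image_union, Finset.union_compl,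
        Finset.coe_image, Finset.coe_univ, Set.image_univ, hx]
    · rw [hn, ← Finset.card_add_card_compl S.toFinset]
      exact_mod_cast Nat.add_le_add Finset.card_image_le Finset.card_image_le
  rw [Finset.coe_image, Set.coe_toFinset] at hreg
  exact (Ideal.Quotient.isDomain_iff_prime _).1 isDomain_of_isRegularLocalRing

theorem notMem_span_image (hn : ringKrullDim R = Fintype.card ι)
    (hx : Ideal.span (Set.range x) = maximalIdeal R) {S : Set ι} {j : ι} (hj : j ∉ S) :
    x j ∉ Ideal.span (x '' S) := by
  intro hmem
  have hm : Ideal.span (x '' {j}ᶜ) = maximalIdeal R := by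
    rw [← hx, ← Set.image_univ, ← Set.union_compl_self {j}, Set.image_union, Ideal.span_union,
      Set.image_singleton]
    refine (sup_eq_right.2 ((Ideal.span_singleton_le_iff_mem _).2 ?_)).symm
    exact Ideal.span_mono (Set.image_mono (Set.subset_compl_singleton_iff.2 hj)) hmem
  have hdim : (Fintype.card ι : WithBot ℕ∞) ≤ (x '' {j}ᶜ).ncard := by
    rw [← hn]
    refine (ringKrullDim_le_spanFinrank_maximalIdeal R).trans ?_
    rw [← hm]
    exact_mod_cast Submodule.spanFinrank_span_le_ncard_of_finite (Set.toFinite _)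
  have hle : (x '' {j}ᶜ).ncard ≤ ({j}ᶜ : Set ι).ncard := Set.ncard_image_le (Set.toFinite _)
  have hcard := Set.ncard_add_ncard_compl {j}
  rw [Set.ncard_singleton, Nat.card_eq_fintype_card] at hcard
  norm_cast at hdim
  lia

theorem isPermutablyRegular_of_span_range_eq_maximalIdeal (hn : ringKrullDim R = Fintype.card ι)
    (hx : Ideal.span (Set.range x) = maximalIdeal R) : IsPermutablyRegular x := by
  intro S j hj
  rw [isSMulRegular_quotient_iff_mem_of_smul_mem]
  intro u hu
  exact ((isPrime_span_image hn hx S).mem_or_mem hu).resolve_left (notMem_span_image hn hx hj)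

end SystemOfParameters

end RegularLocalRing

theorem pow_mem_pow_ceil {R : Type*} [CommRing R] {a : Ideal R} {p e : ℕ} {c : ℝ} {h : R}
    (hh : h ∈ a ^ ⌈c * (p : ℝ) ^ e⌉₊) (k : ℕ) : h ^ p ^ k ∈ a ^ ⌈c * (p : ℝ) ^ (k + e)⌉₊ := by
  refine Ideal.pow_le_pow_right ?_ (pow_mul a _ (p ^ k) ▸ Ideal.pow_mem_pow hh (p ^ k))
  refine Nat.ceil_le.2 ?_
  push_cast
  rw [pow_add, mul_left_comm, mul_comm]
  exact mul_le_mul_of_nonneg_right (Nat.le_ceil _) (by positivity)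

namespace TopCech

variable {R : Type*} [CommRing R] {n : ℕ} {x : Fin n → R}

section Boundary

variable (x) in
/-- The fraction `u / (x_1 ⋯ x_n)^d` in `R_{x_1 ⋯ x_n}`, whose class in `E` is `cls x u d`. -/
def frac (u : R) (d : ℕ) : TopRing x :=
  Localization.mk u ⟨(∏ j, x j) ^ d, d, rfl⟩

theorem smul_frac (r u : R) (d : ℕ) : r • frac x u d = frac x (r * u) d := by
  rw [frac, Localization.smul_mk, smul_eq_mul, frac]

theorem frac_add (u v : R) (d : ℕ) : frac x (u + v) d = frac x u d + frac x v d := by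
  rw [← mul_one u, ← mul_one v, ← add_mul]
  simp only [← smul_frac, add_smul]

theorem frac_eq_frac_iff {u v : R} {d k : ℕ} :
    frac x u d = frac x v k ↔
      ∃ l, (∏ j, x j) ^ l * ((∏ j, x j) ^ k * u) = (∏ j, x j) ^ l * ((∏ j, x j) ^ d * v) := by
  simp only [frac, Localization.mk_eq_mk_iff, Localization.r_iff_exists, Subtype.exists,
    Submonoid.mem_powers_iff, exists_prop, exists_exists_eq_and]

theorem frac_mul_prod_pow (u : R) (d k : ℕ) :
    frac x (u * (∏ j, x j) ^ k) (d + k) = frac x u d :=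
  frac_eq_frac_iff.2 ⟨0, by ring⟩

theorem exists_eq_frac (z : TopRing x) : ∃ u d, z = frac x u d := by
  induction z using Localization.induction_on with
  | H y => obtain ⟨u, _, d, rfl⟩ := y; exact ⟨u, d, rfl⟩

theorem faceMap_mk (i : Fin n) (u : R) (d : ℕ) :
    faceMap x i (Localization.mk u ⟨(∏ j ∈ Finset.univ.erase i, x j) ^ d, d, rfl⟩) =
      frac x (u * x i ^ d) d := by
  have hprod : (∏ j, x j) ^ d = (∏ j ∈ Finset.univ.erase i, x j) ^ d * x i ^ d := by
    rw [← mul_pow, Finset.prod_erase_mul _ _ (Finset.mem_univ i)]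
  have hcancel := IsLocalization.mk'_spec (FaceRing x i) u
    (⟨_, d, rfl⟩ : Submonoid.powers (∏ j ∈ Finset.univ.erase i, x j))
  rw [frac, Localization.mk_eq_mk', Localization.mk_eq_mk', IsLocalization.eq_mk'_iff_mul_eq]
  simp only at hcancel ⊢
  rw [hprod, map_mul, map_mul, ← mul_assoc,
    ← (faceMap x i).commutes ((∏ j ∈ Finset.univ.erase i, x j) ^ d), ← map_mul, hcancel,
    AlgHom.commutes]

theorem exists_mem_spanPow_eq_frac {z : TopRing x} (hz : z ∈ boundary x) :
    ∃ d, ∃ u ∈ spanPow x (Function.const _ d) Set.univ, z = frac x u d := by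
  refine Submodule.iSup_induction _ (motive := fun z =>
    ∃ d, ∃ u ∈ spanPow x (Function.const _ d) Set.univ, z = frac x u d) hz ?_ ?_ ?_
  · rintro i _ ⟨w, rfl⟩
    induction w using Localization.induction_on with
    | H y =>
      obtain ⟨u, _, d, rfl⟩ := y
      exact ⟨d, u * x i ^ d, Ideal.mul_mem_left _ _ (pow_mem_spanPow (Set.mem_univ i) le_rfl),
        faceMap_mk i u d⟩
  · exact ⟨0, 0, zero_mem _, (Localization.mk_zero _).symm⟩
  · rintro _ _ ⟨d, u, hu, rfl⟩ ⟨k, v, hv, rfl⟩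
    refine ⟨d + k, u * (∏ j, x j) ^ k + v * (∏ j, x j) ^ d, add_mem ?_ ?_, ?_⟩
    · rw [← Finset.prod_pow]
      exact mul_prod_pow_mem_spanPow (b := Function.const _ k) hu
    · rw [add_comm d, ← Finset.prod_pow]
      exact mul_prod_pow_mem_spanPow (b := Function.const _ d) hv
    · rw [frac_add, frac_mul_prod_pow, add_comm d, frac_mul_prod_pow]

end Boundary

section Cls

theorem smul_cls (r u : R) (d : ℕ) : r • cls x u d = cls x (r * u) d :=
  congrArg Submodule.Quotient.mk (smul_frac r u d)

theorem cls_mul_prod_pow (u : R) (d k : ℕ) :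
    cls x (u * (∏ j, x j) ^ k) (d + k) = cls x u d :=
  congrArg Submodule.Quotient.mk (frac_mul_prod_pow u d k)

theorem cls_sub (u v : R) (d : ℕ) : cls x (u - v) d = cls x u d - cls x v d := by
  rw [← mul_one u, ← mul_one v, ← sub_mul]
  simp only [← smul_cls, sub_smul]

theorem exists_eq_cls (w : E x) : ∃ u d, w = cls x u d := by
  obtain ⟨z, rfl⟩ := Submodule.Quotient.mk_surjective _ w
  obtain ⟨u, d, rfl⟩ := exists_eq_frac z
  exact ⟨u, d, rfl⟩

theorem cls_mem_of_le {N : Submodule R (E x)} {d k : ℕ} (hdk : d ≤ k) (hN : cls x 1 k ∈ N)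
    (u : R) : cls x u d ∈ N := by
  obtain ⟨l, rfl⟩ := Nat.exists_eq_add_of_le hdk
  rw [← cls_mul_prod_pow u d l, ← mul_one (_ * _), ← smul_cls]
  exact N.smul_mem _ hN

theorem cls_eq_zero_of_mem_spanPow {u : R} {d : ℕ}
    (hu : u ∈ spanPow x (Function.const _ d) Set.univ) : cls x u d = 0 := by
  have hle : spanPow x (Function.const _ d) Set.univ ≤
      LinearMap.ker (LinearMap.toSpanSingleton R (E x) (cls x 1 d)) := by
    refine spanPow_le_iff.2 fun i _ => ?_
    rw [LinearMap.mem_ker, LinearMap.toSpanSingleton_apply, smul_cls, mul_one]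
    refine (Submodule.Quotient.mk_eq_zero _).2 (Submodule.mem_iSup_of_mem i
      ⟨_, (faceMap_mk i 1 d).trans ?_⟩)
    rw [Function.const_apply, one_mul, frac]
  simpa only [LinearMap.mem_ker, LinearMap.toSpanSingleton_apply, smul_cls, mul_one] using hle hu

theorem cls_eq_zero_iff (hx : IsPermutablyRegular x) {u : R} {d : ℕ} :
    cls x u d = 0 ↔ u ∈ spanPow x (Function.const _ d) Set.univ := by
  refine ⟨fun h => ?_, cls_eq_zero_of_mem_spanPow⟩
  obtain ⟨k, v, hv, huv⟩ := exists_mem_spanPow_eq_frac ((Submodule.Quotient.mk_eq_zero _).1 h)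
  obtain ⟨l, hl⟩ := frac_eq_frac_iff.1 huv
  refine hx.mem_spanPow_of_mul_prod_pow_mem (b := Function.const _ (l + k)) ?_
  have hul : u * (∏ j, x j) ^ (l + k) = v * (∏ j, x j) ^ (l + d) := by linear_combination hl
  have hmem := mul_prod_pow_mem_spanPow (b := Function.const _ (l + d)) hv
  simp only [Function.const_apply, Finset.prod_pow] at hmem ⊢
  rw [hul]
  convert! hmem using 2
  funext
  simp only [Pi.add_apply, Function.const_apply]
  ring

theorem exists_smul_eq_cls_one_one [IsLocalRing R]
    (hx : Ideal.span (Set.range x) = maximalIdeal R) {w : E x} (hw : w ≠ 0) :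
    ∃ r : R, r • w = cls x 1 1 := by
  obtain ⟨u, d, rfl⟩ := exists_eq_cls w
  rw [← cls_mul_prod_pow u d 1] at hw ⊢
  obtain ⟨r, hr⟩ := exists_mul_sub_prod_pow_mem_spanPow hx (Function.const _ d) _
    fun h => hw (cls_eq_zero_of_mem_spanPow h)
  have hsub := cls_eq_zero_of_mem_spanPow (d := d + 1) hr
  refine ⟨r, ?_⟩
  rw [cls_sub, sub_eq_zero] at hsub
  simp only [Function.const_apply, Finset.prod_pow] at hsub
  rw [smul_cls, hsub, ← cls_mul_prod_pow 1 1 d, one_mul, add_comm]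

theorem annihilator_eq_bot [IsLocalRing R] [IsNoetherianRing R] (hx : IsPermutablyRegular x)
    (hxtop : Ideal.span (Set.range x) ≠ ⊤) : Module.annihilator R (E x) = ⊥ := by
  refine eq_bot_iff.2 fun r hr => ?_
  rw [← Ideal.iInf_pow_eq_bot_of_isLocalRing _ hxtop]
  refine (Submodule.mem_iInf _).2 fun d => ?_
  have hr0 : cls x r d = 0 := by
    rw [← mul_one r, ← smul_cls, Module.mem_annihilator.1 hr]
  refine spanPow_le_iff.2 (fun i _ => ?_) ((cls_eq_zero_iff hx).1 hr0)
  exact Ideal.pow_mem_pow (Ideal.subset_span (Set.mem_range_self i)) d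

end Cls

section Frobenius

variable {p : ℕ} [ExpChar R p] {a : Ideal R} {c : ℝ}

theorem iterate_FE_cls (e : ℕ) (u : R) (d : ℕ) :
    (FE p x)^[e] (cls x u d) = cls x (u ^ p ^ e) (p ^ e * d) := by
  induction e with
  | zero => simp
  | succ e ih =>
    rw [Function.iterate_succ_apply', ih, FE_cls, ← pow_mul, ← pow_succ, ← mul_assoc, ← pow_succ']

theorem smul_iterate_FE_smul_iterate_FE (g h : R) (k e : ℕ) (w : E x) :
    g • (FE p x)^[k] (h • (FE p x)^[e] w) = (g * h ^ p ^ k) • (FE p x)^[k + e] w := by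
  rw [iterate_FE_smul, ← Function.iterate_add_apply, smul_smul]

theorem eq_top_of_forall_iterate_FE_mem {N : Submodule R (E x)} (e : ℕ)
    (hN : ∀ w, (FE p x)^[e] w ∈ N) : N = ⊤ := by
  refine eq_top_iff.2 fun w _ => ?_
  obtain ⟨u, d, rfl⟩ := exists_eq_cls w
  refine cls_mem_of_le (Nat.le_mul_of_pos_left d (pow_pos (expChar_pos R p) e)) ?_ u
  simpa only [iterate_FE_cls, one_pow] using hN (cls x 1 d)

theorem eq_top_of_forall_iterate_FE_cls_one_one_mem (hp : 1 < p) {N : Submodule R (E x)}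
    (hN : ∀ e, (FE p x)^[e] (cls x 1 1) ∈ N) : N = ⊤ := by
  refine eq_top_iff.2 fun w _ => ?_
  obtain ⟨u, d, rfl⟩ := exists_eq_cls w
  refine cls_mem_of_le (Nat.lt_pow_self hp).le ?_ u
  simpa only [iterate_FE_cls, one_pow, mul_one] using hN d

theorem mem_Z_iff {w : E x} :
    w ∈ Z p x a c ↔ ∀ e, 1 ≤ e → ∀ h ∈ a ^ ⌈c * (p : ℝ) ^ e⌉₊, h • (FE p x)^[e] w = 0 := by
  simp only [Z, Submodule.mem_iInf]
  rfl

theorem isInvariant_Z : IsInvariant p x a c (Z p x a c) := by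
  intro e he h hh w hw
  refine mem_Z_iff.2 fun k _ g _ => ?_
  rw [smul_iterate_FE_smul_iterate_FE, mul_smul,
    mem_Z_iff.1 hw (k + e) (by lia) _ (pow_mem_pow_ceil hh k), smul_zero]

theorem le_Z_of_isInvariant [IsLocalRing R] (hp : 1 < p)
    (hx : Ideal.span (Set.range x) = maximalIdeal R) {N : Submodule R (E x)}
    (hN : IsInvariant p x a c N) (hNtop : N ≠ ⊤) : N ≤ Z p x a c := by
  intro w hw
  refine mem_Z_iff.2 fun e he h hh => ?_
  by_contra hne
  obtain ⟨r, hr⟩ := exists_smul_eq_cls_one_one hx hne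
  refine hNtop (eq_top_of_forall_iterate_FE_cls_one_one_mem hp fun k => ?_)
  rw [← hr, iterate_FE_smul, ← one_smul R ((FE p x)^[k] _), smul_iterate_FE_smul_iterate_FE,
    one_mul]
  exact N.smul_mem _ (hN (k + e) (by lia) _ (pow_mem_pow_ceil hh k) w hw)

theorem Z_ne_top [IsLocalRing R] [IsNoetherianRing R] (hx : IsPermutablyRegular x)
    (hxtop : Ideal.span (Set.range x) ≠ ⊤) (ha : ¬IsNilpotent a) : Z p x a c ≠ ⊤ := by
  intro htop
  refine ha ⟨⌈c * (p : ℝ) ^ 1⌉₊, eq_bot_iff.2 fun h hh => ?_⟩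
  have hker : LinearMap.ker (LinearMap.lsmul R (E x) h) = ⊤ :=
    eq_top_of_forall_iterate_FE_mem (p := p) 1 fun w =>
      mem_Z_iff.1 (htop ▸ Submodule.mem_top : w ∈ Z p x a c) 1 le_rfl h hh
  rw [← annihilator_eq_bot hx hxtop, Module.mem_annihilator]
  exact fun w => LinearMap.mem_ker.1 (hker ▸ Submodule.mem_top : w ∈ _)

end Frobenius

end TopCech

theorem mainTheorem7 {R : Type*} [CommRing R] [IsRegularLocalRing R]
    (p : ℕ) [Fact p.Prime] [CharP R p]
    (n : ℕ) (hn : ringKrullDim R = n)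
    (x : Fin n → R) (hx : Ideal.span (Set.range x) = maximalIdeal R)
    (a : Ideal R) (ha0 : a ≠ ⊥) (ham : a ≤ maximalIdeal R)
    (c : ℝ) (hc : 0 < c) :
    IsGreatest {N : Submodule R (TopCech.E x) | N ≠ ⊤ ∧ TopCech.IsInvariant p x a c N}
        (TopCech.Z p x a c) ∧
      ∀ N : Submodule R (TopCech.E x),
        Maximal (fun N' => N' ≠ ⊤ ∧ TopCech.IsInvariant p x a c N') N ↔
          N = TopCech.Z p x a c := by
  have : IsDomain R := isDomain_of_isRegularLocalRing
  have hreg : IsPermutablyRegular x :=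
    isPermutablyRegular_of_span_range_eq_maximalIdeal (by rw [hn, Fintype.card_fin]) hx
  have hxtop : Ideal.span (Set.range x) ≠ ⊤ := hx ▸ Ideal.IsPrime.ne_top'
  have ha : ¬IsNilpotent a := fun h => ha0 h.eq_zero
  have hp : 1 < p := (Fact.out : p.Prime).one_lt
  have hZ : IsGreatest {N : Submodule R (TopCech.E x) | N ≠ ⊤ ∧ TopCech.IsInvariant p x a c N}
      (TopCech.Z p x a c) :=
    ⟨⟨TopCech.Z_ne_top hreg hxtop ha, TopCech.isInvariant_Z⟩,
      fun _ hN => TopCech.le_Z_of_isInvariant hp hx hN.2 hN.1⟩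
  refine ⟨hZ, fun N => ⟨fun hN => hN.eq_of_le hZ.1 (hZ.2 hN.prop), ?_⟩⟩
  rintro rfl
  exact ⟨hZ.1, fun N hN _ => hZ.2 hN⟩
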